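/- Let $d\ge 1$ and let $\theta_i=(w_i,b_i),\ \theta_j=(w_j,b_j)\in\mathbb{R}^d\times\mathbb{R}$. For an activation $\sigma:\mathbb{R}\to\mathbb{R}$, a measure $\mu$ on a space $\mathbb{X}$ and a sufficient statistic $t:\mathbb{X}\to\mathbb{R}^d$, write $$k_{\sigma,t,\mu}(\theta_i,\theta_j)=\int_{\mathbb{X}}\sigma\big(w_i^\top t(x)+b_i\big)\,\sigma\big(w_j^\top t(x)+b_j\big)\,\mu(dx).$$ Let $\Phi$ be the standard Gaussian measure on $\mathbb{R}^d$, let $\mathrm{proj}(x)=x/\|x\|$ for $x\ne 0$ (with $\mathrm{proj}(0)=0$, say), let $\nu$ be the uniform probability measure on the unit sphere $S^{d-1}\subset\mathbb{R}^d$, and let $\mathrm{Id}$ be the inclusion $S^{d-1}\hookrightarrow\mathbb{R}^d$. Let $$I_p(z)=\sum_{k\ge 0}\frac{(z/2)^{2k+p}}{k!\,\Gamma(k+p+1)}\qquad (z>0)$$ be the modified Bessel function of the first kind of order $p$. Then the image of $\Phi$ under $\mathrm{proj}$ is $\nu$ (as a measure on $\mathbb{R}^d$), the integrals defining $k_{\exp,\mathrm{proj},\Phi}$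 and $k_{\exp,\mathrm{Id},\nu}$ converge, and $$k_{\exp,\mathrm{proj},\Phi}(\theta_i,\theta_j)=k_{\exp,\mathrm{Id},\nu}(\theta_i,\theta_j)=\exp(b_i+b_j)\,\frac{\Gamma(d/2)\,2^{d/2-1}\,I_{d/2-1}(\|w_i+w_j\|)}{\|w_i+w_j\|^{d/2-1}}\qquad\text{if } w_i+w_j\neq 0.$$ If $w_i+w_j=0$, both kernels equal $\exp(b_i+b_j)$, which is the limit of $\exp(b_i+b_j)\,\Gamma(d/2)\,2^{d/2-1}I_{d/2-1}(r)/r^{d/2-1}$ as $r\to 0^+$. For $d=3$ and $w_i+w_j\ne 0$, $$k_{\exp,\mathrm{proj},\Phi}(\theta_i,\theta_j)=\exp(b_i+b_j)\,\frac{\sinh(\|w_i+w_j\|)}{\|w_i+w_j\|}.$$ -/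

import Mathlib

open MeasureTheory ProbabilityTheory Filter
open scoped Topology

noncomputable section

/-- A neuron's parameter `θ = (w, b)`: a weight vector in `ℝ^d` and a scalar bias. -/
abbrev NeuronParam (d : ℕ) : Type := EuclideanSpace ℝ (Fin d) × ℝ

/-- The integrand `σ(w_i^⊤ t(x) + b_i) σ(w_j^⊤ t(x) + b_j)` of the neural network kernel. -/
def nnkIntegrand {X : Type*} {d : ℕ} (σ : ℝ → ℝ) (t : X → EuclideanSpace ℝ (Fin d))
    (θi θj : NeuronParam d) (x : X) : ℝ :=
  σ (inner ℝ θi.1 (t x) + θi.2) * σ (inner ℝ θj.1 (t x) + θj.2)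

/-- The neural network kernel `k_{σ,t,μ}(θ_i, θ_j)` with activation `σ`, sufficient statistic `t`
and base measure `μ`. -/
def nnKernel {X : Type*} [MeasurableSpace X] {d : ℕ} (σ : ℝ → ℝ)
    (t : X → EuclideanSpace ℝ (Fin d)) (μ : Measure X) (θi θj : NeuronParam d) : ℝ :=
  ∫ x, nnkIntegrand σ t θi θj x ∂μ

/-- The projection `x ↦ x / ‖x‖` onto the unit sphere (its value at `0`, a Gaussian null set
in positive dimension, is `0`). -/
def sphereProj (d : ℕ) (x : EuclideanSpace ℝ (Fin d)) : EuclideanSpace ℝ (Fin d) :=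
  ‖x‖⁻¹ • x

/-- The uniform probability measure on the unit sphere `S^{d-1}` of `ℝ^d` (`1 ≤ d`): the surface
measure divided by its total mass. -/
def uniformSphere (d : ℕ) : Measure (Metric.sphere (0 : EuclideanSpace ℝ (Fin d)) 1) :=
  ((volume : Measure (EuclideanSpace ℝ (Fin d))).toSphere Set.univ)⁻¹ •
    (volume : Measure (EuclideanSpace ℝ (Fin d))).toSphere

/-- The modified Bessel function of the first kind of real order `p`, at `z > 0`:
`I_p(z) = ∑_{k ≥ 0} (z/2)^(2k+p) / (k! Γ(k+p+1))`. -/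
def besselI (p z : ℝ) : ℝ :=
  ∑' k : ℕ, (z / 2) ^ (2 * (k : ℝ) + p) / ((k.factorial : ℝ) * Real.Gamma ((k : ℝ) + p + 1))

/-- `Γ(d/2) 2^(d/2-1) I_{d/2-1}(r) / r^(d/2-1)`, for `r > 0`. -/
def vmfRadial (d : ℕ) (r : ℝ) : ℝ :=
  Real.Gamma ((d : ℝ) / 2) * (2 : ℝ) ^ ((d : ℝ) / 2 - 1) * besselI ((d : ℝ) / 2 - 1) r /
    r ^ ((d : ℝ) / 2 - 1)

end

/-! ### Gaussian density, polar coordinates and moments. -/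

section StdGaussian

variable {E : Type*} [NormedAddCommGroup E] [InnerProductSpace ℝ E]

/-! The Gaussian density is radial, so in polar coordinates norm and direction separate and the
direction is uniform (`integral_stdGaussian_norm_mul_direction`). Hence both kernels equal `exp (b_i
+ b_j)` times `∫ exp ⟨w, u⟩ dν` with `w = w_i + w_j`. By symmetry `exp` may be replaced by `cosh`,
which is integrated term by term. The same separation gives the spherical moments of `⟨w, u⟩` as
Gaussian moments of `⟨w, x⟩` divided by those of `‖x‖`, and the Gamma ratios that result are the
Bessel coefficients (`hasSum_integral_uniformSphere_exp_inner`). -/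

/-- The Lebesgue density of the standard Gaussian measure. -/
noncomputable def stdGaussianPDFReal (x : E) : ℝ :=
  ((2 * Real.pi) ^ (Module.finrank ℝ E / 2 : ℝ))⁻¹ * Real.exp (-(1 / 2) * ‖x‖ ^ 2)

lemma stdGaussianPDFReal_nonneg (x : E) : 0 ≤ stdGaussianPDFReal x := by
  unfold stdGaussianPDFReal; positivity

lemma continuous_stdGaussianPDFReal : Continuous (stdGaussianPDFReal (E := E)) := by
  unfold stdGaussianPDFReal; fun_prop

variable [FiniteDimensional ℝ E] [MeasurableSpace E] [BorelSpace E]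

lemma integral_stdGaussianPDFReal : ∫ x : E, stdGaussianPDFReal x = 1 := by
  unfold stdGaussianPDFReal
  rw [integral_const_mul, GaussianFourier.integral_rexp_neg_mul_sq_norm (by norm_num)]
  rw [show Real.pi / (1 / 2) = 2 * Real.pi by ring]
  exact inv_mul_cancel₀ (by positivity)

lemma integrable_stdGaussianPDFReal : Integrable (stdGaussianPDFReal (E := E)) :=
  Integrable.of_integral_ne_zero (by simp [integral_stdGaussianPDFReal])

lemma integral_withDensity_stdGaussianPDFReal {F : Type*} [NormedAddCommGroup F] [NormedSpace ℝ F]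
    (f : E → F) :
    ∫ x, f x ∂(volume.withDensity fun x : E ↦ ENNReal.ofReal (stdGaussianPDFReal x)) =
      ∫ x, stdGaussianPDFReal x • f x := by
  rw [integral_withDensity_eq_integral_toReal_smul
    continuous_stdGaussianPDFReal.measurable.ennreal_ofReal (by simp)]
  simp [ENNReal.toReal_ofReal (stdGaussianPDFReal_nonneg _)]

/-- Both sides have the same characteristic function, by the Gaussian Fourier integral at frequency
`I`. -/
lemma stdGaussian_eq_withDensity :
    stdGaussian E = volume.withDensity fun x : E ↦ ENNReal.ofReal (stdGaussianPDFReal x) := by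
  have : IsFiniteMeasure (volume.withDensity fun x : E ↦ ENNReal.ofReal (stdGaussianPDFReal x)) :=
    isFiniteMeasure_withDensity_ofReal integrable_stdGaussianPDFReal.2
  apply Measure.ext_of_charFun
  ext t
  rw [charFun_stdGaussian, charFun_apply, integral_withDensity_stdGaussianPDFReal]
  have h := GaussianFourier.integral_cexp_neg_mul_sq_norm_add (V := E) (b := 1 / 2) (by norm_num)
    Complex.I t
  have hpi : ((Real.pi : ℂ) / (1 / 2)) ^ (Module.finrank ℝ E / 2 : ℂ) =
      (((2 * Real.pi) ^ (Module.finrank ℝ E / 2 : ℝ) : ℝ) : ℂ) := by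
    rw [Complex.ofReal_cpow (by positivity)]
    push_cast
    ring_nf
  rw [hpi] at h
  have hne : (((2 * Real.pi) ^ (Module.finrank ℝ E / 2 : ℝ) : ℝ) : ℂ) ≠ 0 := by
    rw [Complex.ofReal_ne_zero]; positivity
  calc Complex.exp (-‖t‖ ^ 2 / 2)
      = ((((2 * Real.pi) ^ (Module.finrank ℝ E / 2 : ℝ) : ℝ) : ℂ))⁻¹ *
        ∫ v : E, Complex.exp (-(1 / 2) * ‖v‖ ^ 2 + Complex.I * (inner ℝ t v : ℝ)) := by
        rw [h, inv_mul_cancel_left₀ hne]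
        congr 1
        rw [Complex.I_sq]; ring
    _ = _ := by
        rw [← integral_const_mul]
        congr 1 with v
        rw [stdGaussianPDFReal, Complex.real_smul, real_inner_comm, Complex.exp_add,
          mul_comm Complex.I]
        push_cast
        ring

lemma integral_stdGaussian_eq {F : Type*} [NormedAddCommGroup F] [NormedSpace ℝ F] (f : E → F) :
    ∫ x, f x ∂stdGaussian E = ∫ x, stdGaussianPDFReal x • f x := by
  rw [stdGaussian_eq_withDensity, integral_withDensity_stdGaussianPDFReal]

/-- Integration of a product of a radial and an angular function in polar coordinates. -/
lemma integral_norm_mul_direction [Nontrivial E] (μ : Measure E) [μ.IsAddHaarMeasure]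
    (g : ℝ → ℝ) (φ : E → ℝ) :
    ∫ x, g ‖x‖ * φ (‖x‖⁻¹ • x) ∂μ =
      (∫ u : Metric.sphere (0 : E) 1, φ u ∂μ.toSphere) *
        ∫ r : Set.Ioi (0 : ℝ), g r ∂Measure.volumeIoiPow (Module.finrank ℝ E - 1) := by
  calc
    ∫ x, g ‖x‖ * φ (‖x‖⁻¹ • x) ∂μ
      = ∫ x : ({(0)}ᶜ : Set E), g ‖x.1‖ * φ (‖x.1‖⁻¹ • x.1) ∂(μ.comap (↑)) := by
      rw [integral_subtype_comap (measurableSet_singleton _).compl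
        fun x ↦ g ‖x‖ * φ (‖x‖⁻¹ • x), restrict_compl_singleton]
    _ = ∫ x, φ x.1 * g x.2 ∂μ.toSphere.prod (.volumeIoiPow (Module.finrank ℝ E - 1)) := by
      rw [← μ.measurePreserving_homeomorphUnitSphereProd.integral_comp
        (Homeomorph.measurableEmbedding _)]
      simp [mul_comm]
    _ = _ := integral_prod_mul (fun u : Metric.sphere (0 : E) 1 ↦ φ u)
      (fun r : Set.Ioi (0 : ℝ) ↦ g r)

/-- Under the standard Gaussian measure, norm and direction are independent and the direction is
uniformly distributed on the sphere. -/
lemma integral_stdGaussian_norm_mul_direction [Nontrivial E] (g : ℝ → ℝ) (φ : E → ℝ) :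
    ∫ x, g ‖x‖ * φ (‖x‖⁻¹ • x) ∂stdGaussian E =
      (∫ u : Metric.sphere (0 : E) 1, φ u
        ∂((volume : Measure E).toSphere Set.univ)⁻¹ • (volume : Measure E).toSphere) *
        ∫ x, g ‖x‖ ∂stdGaussian E := by
  set G : ℝ → ℝ := fun r ↦
    ((2 * Real.pi) ^ (Module.finrank ℝ E / 2 : ℝ))⁻¹ * Real.exp (-(1 / 2) * r ^ 2) * g r
  -- `G` absorbs the density. The case `φ = 1` expresses the radial integral through `∫ g ‖x‖` and
  -- the total mass of the sphere.
  have h₁ := integral_norm_mul_direction (volume : Measure E) G φ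
  have h₂ := integral_norm_mul_direction (volume : Measure E) G 1
  have hS : (volume : Measure E).toSphere.real Set.univ ≠ 0 := by
    rw [measureReal_ne_zero_iff, Measure.measure_univ_ne_zero]
    exact Measure.toSphere_ne_zero _
  rw [integral_stdGaussian_eq, integral_stdGaussian_eq, integral_smul_measure]
  simp only [stdGaussianPDFReal, smul_eq_mul, ← mul_assoc] at *
  simp only [Pi.one_apply, mul_one, integral_const, smul_eq_mul] at h₂
  rw [h₁, h₂, ENNReal.toReal_inv, ← measureReal_def]
  field_simp

lemma integral_stdGaussian_direction [Nontrivial E] (φ : E → ℝ) :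
    ∫ x, φ (‖x‖⁻¹ • x) ∂stdGaussian E = ∫ u : Metric.sphere (0 : E) 1, φ u
        ∂((volume : Measure E).toSphere Set.univ)⁻¹ • (volume : Measure E).toSphere := by
  simpa using integral_stdGaussian_norm_mul_direction (fun _ ↦ 1) φ

lemma integral_pow_mul_exp_neg_half_sq (n : ℕ) :
    ∫ y in Set.Ioi (0 : ℝ), y ^ n * Real.exp (-(1 / 2) * y ^ 2) =
      (2 : ℝ) ^ ((n + 1 : ℝ) / 2) * (1 / 2) * Real.Gamma ((n + 1) / 2) := by
  have h := integral_rpow_mul_exp_neg_mul_rpow (p := 2) (q := n) (b := 1 / 2) (by norm_num)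
    (by linarith [n.cast_nonneg (α := ℝ)]) (by norm_num)
  simp only [Real.rpow_natCast, Real.rpow_ofNat] at h
  rw [h, one_div, Real.inv_rpow (by norm_num), ← Real.rpow_neg (by norm_num)]
  congr 3
  ring

/-- Polar coordinates give a Gamma integral times a constant independent of `k`. The case `k = 0`
(total mass one) fixes that constant, so the volume of the ball is never computed. -/
lemma integral_norm_pow_stdGaussian [Nontrivial E] (k : ℕ) :
    (∫ x, ‖x‖ ^ (2 * k) ∂stdGaussian E) * Real.Gamma (Module.finrank ℝ E / 2) =
      2 ^ k * Real.Gamma (k + Module.finrank ℝ E / 2) := by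
  set d := Module.finrank ℝ E with hd
  have hd0 : 0 < d := Module.finrank_pos
  set c := ((2 * Real.pi) ^ (d / 2 : ℝ))⁻¹
  have key (k : ℕ) : ∫ x, ‖x‖ ^ (2 * k) ∂stdGaussian E =
      (d * volume.real (Metric.ball (0 : E) 1) * c * 2 ^ (d / 2 : ℝ) * (1 / 2)) *
        (2 ^ k * Real.Gamma (k + d / 2)) := by
    rw [integral_stdGaussian_eq]
    have h := integral_fun_norm_addHaar (volume : Measure E)
      (fun r ↦ c * Real.exp (-(1 / 2) * r ^ 2) * r ^ (2 * k))
    simp only [stdGaussianPDFReal, smul_eq_mul, nsmul_eq_mul, ← hd] at h ⊢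
    rw [h]
    have h' : ∀ y : ℝ, y ^ (d - 1) * (c * Real.exp (-(1 / 2) * y ^ 2) * y ^ (2 * k)) =
        c * (y ^ (d - 1 + 2 * k) * Real.exp (-(1 / 2) * y ^ 2)) := by
      intro y; rw [pow_add]; ring
    simp_rw [h']
    rw [integral_const_mul, integral_pow_mul_exp_neg_half_sq]
    have e : (((d - 1 + 2 * k : ℕ) : ℝ) + 1) / 2 = k + d / 2 := by
      rw [Nat.cast_add, Nat.cast_sub hd0]; push_cast; ring
    rw [e, Real.rpow_add (by norm_num), Real.rpow_natCast]
    ring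
  have h0 := key 0
  simp only [mul_zero, pow_zero, integral_const, probReal_univ, smul_eq_mul, mul_one,
    one_mul, CharP.cast_eq_zero, zero_add] at h0
  rw [key k, mul_right_comm, ← h0, one_mul]

lemma stdGaussian_real : stdGaussian ℝ = gaussianReal 0 1 := by
  apply Measure.ext_of_charFun
  ext t
  rw [charFun_stdGaussian, charFun_gaussianReal]
  simp [neg_div, ← Complex.ofReal_pow]

lemma map_inner_stdGaussian (w : E) :
    (stdGaussian E).map (fun x ↦ inner ℝ w x) = (stdGaussian ℝ).map (fun y ↦ ‖w‖ * y) := by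
  have h := IsGaussian.map_eq_gaussianReal (μ := stdGaussian E) (innerSL ℝ w)
  rw [integral_strongDual_stdGaussian, variance_dual_stdGaussian, innerSL_apply_norm] at h
  rw [stdGaussian_real, gaussianReal_map_const_mul]
  refine Eq.trans h ?_
  congr 1
  · simp
  · ext; simp

lemma integral_inner_pow_stdGaussian (w : E) (k : ℕ) :
    ∫ x, (inner ℝ w x : ℝ) ^ (2 * k) ∂stdGaussian E =
      ‖w‖ ^ (2 * k) * ((2 * k).factorial / (2 ^ k * k.factorial)) := by
  have hk := integral_norm_pow_stdGaussian (E := ℝ) k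
  rw [← integral_map (φ := fun x ↦ inner ℝ w x) (f := fun y : ℝ ↦ y ^ (2 * k))
    (by fun_prop) (by fun_prop), map_inner_stdGaussian,
    integral_map (by fun_prop) (by fun_prop)]
  simp only [mul_pow]
  rw [integral_const_mul]
  congr 1
  simp only [Real.norm_eq_abs, pow_mul, sq_abs, Module.finrank_self, Nat.cast_one,
    Real.Gamma_one_half_eq] at hk
  -- Legendre duplication turns `Γ(k + 1/2)`, from the norm moment on `ℝ`, into factorials.
  have hdup := Real.Gamma_mul_Gamma_add_half (k + 1 / 2)
  rw [show (k : ℝ) + 1 / 2 + 1 / 2 = k + 1 by ring,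
    show 2 * ((k : ℝ) + 1 / 2) = ((2 * k : ℕ) : ℝ) + 1 by push_cast; ring,
    Real.Gamma_nat_eq_factorial, Real.Gamma_nat_eq_factorial,
    show 1 - (((2 * k : ℕ) : ℝ) + 1) = -((2 * k : ℕ) : ℝ) by ring,
    Real.rpow_neg (by norm_num), Real.rpow_natCast] at hdup
  have hpi : √Real.pi ≠ 0 := by positivity
  have hf : (k.factorial : ℝ) ≠ 0 := by positivity
  simp only [pow_mul] at hdup ⊢
  have hG := eq_div_of_mul_eq hf hdup
  rw [hG] at hk
  rw [eq_div_of_mul_eq hpi hk]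
  have : ((2:ℝ)^2)^k = 2^k * 2^k := by rw [← mul_pow]; norm_num
  rw [this]
  field_simp

end StdGaussian

/-! ### Exponential integrals over the sphere. -/

section UniformSphere

variable {d : ℕ}

lemma nontrivial_euclideanSpace_fin (hd : 1 ≤ d) : Nontrivial (EuclideanSpace ℝ (Fin d)) :=
  Module.nontrivial_of_finrank_pos (R := ℝ) (by rw [finrank_euclideanSpace_fin]; exact hd)

lemma isProbabilityMeasure_uniformSphere (hd : 1 ≤ d) :
    IsProbabilityMeasure (uniformSphere d) := by
  have := nontrivial_euclideanSpace_fin hd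
  have : NeZero (volume : Measure (EuclideanSpace ℝ (Fin d))).toSphere :=
    ⟨Measure.toSphere_ne_zero _⟩
  exact isProbabilityMeasureSMul

lemma measurable_sphereProj (d : ℕ) : Measurable (sphereProj d) := by
  unfold sphereProj; fun_prop

lemma integral_sphereProj (hd : 1 ≤ d) (φ : EuclideanSpace ℝ (Fin d) → ℝ) :
    ∫ x, φ (sphereProj d x) ∂stdGaussian (EuclideanSpace ℝ (Fin d)) =
      ∫ u, φ u ∂uniformSphere d := by
  have := nontrivial_euclideanSpace_fin hd
  exact integral_stdGaussian_direction φ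

/-- The law of the direction of a standard Gaussian vector is uniform on the sphere. -/
lemma map_sphereProj_stdGaussian (hd : 1 ≤ d) :
    (stdGaussian (EuclideanSpace ℝ (Fin d))).map (sphereProj d) =
      (uniformSphere d).map Subtype.val := by
  have := isProbabilityMeasure_uniformSphere hd
  have hm : Measurable (Subtype.val : Metric.sphere (0 : EuclideanSpace ℝ (Fin d)) 1 → _) :=
    measurable_subtype_coe
  have := Measure.isProbabilityMeasure_map (μ := stdGaussian (EuclideanSpace ℝ (Fin d)))
    (measurable_sphereProj d).aemeasurable
  have := Measure.isProbabilityMeasure_map (μ := uniformSphere d) hm.aemeasurable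
  refine Measure.ext fun s hs ↦
    (ENNReal.toReal_eq_toReal_iff' (measure_ne_top _ _) (measure_ne_top _ _)).1 ?_
  rw [← measureReal_def, ← measureReal_def]
  have hi : Measurable (s.indicator (1 : EuclideanSpace ℝ (Fin d) → ℝ)) :=
    measurable_one.indicator hs
  rw [← integral_indicator_one hs, ← integral_indicator_one hs,
    integral_map (measurable_sphereProj d).aemeasurable hi.aestronglyMeasurable,
    integral_map hm.aemeasurable hi.aestronglyMeasurable]
  exact integral_sphereProj hd _

lemma integrable_uniformSphere (hd : 1 ≤ d)
    {f : Metric.sphere (0 : EuclideanSpace ℝ (Fin d)) 1 → ℝ} (hf : Continuous f) :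
    Integrable f (uniformSphere d) := by
  have := isProbabilityMeasure_uniformSphere hd
  exact hf.integrable_of_hasCompactSupport (HasCompactSupport.of_compactSpace f)

lemma integral_uniformSphere_inner_pow (hd : 1 ≤ d) (w : EuclideanSpace ℝ (Fin d)) (k : ℕ) :
    ∫ u, (inner ℝ w u.1 : ℝ) ^ (2 * k) ∂uniformSphere d =
      (2 * k).factorial * (Real.Gamma (d / 2) * (‖w‖ / 2) ^ (2 * k) /
        (k.factorial * Real.Gamma (k + d / 2))) := by
  have := nontrivial_euclideanSpace_fin hd
  have h := integral_stdGaussian_norm_mul_direction (E := EuclideanSpace ℝ (Fin d))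
    (fun r ↦ r ^ (2 * k)) (fun u ↦ (inner ℝ w u) ^ (2 * k))
  have hx : ∀ x : EuclideanSpace ℝ (Fin d),
      ‖x‖ ^ (2 * k) * (inner ℝ w (‖x‖⁻¹ • x)) ^ (2 * k) = (inner ℝ w x) ^ (2 * k) := by
    intro x
    rw [← mul_pow, inner_smul_right]
    rcases eq_or_ne x 0 with rfl | hx
    · simp
    · rw [mul_inv_cancel_left₀ (norm_ne_zero_iff.2 hx)]
  simp only [hx] at h
  have hn := integral_norm_pow_stdGaussian (E := EuclideanSpace ℝ (Fin d)) k
  rw [finrank_euclideanSpace_fin] at hn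
  have hd' : (0 : ℝ) < d := by exact_mod_cast hd
  have hG : Real.Gamma (d / 2) ≠ 0 := (Real.Gamma_pos_of_pos (by positivity)).ne'
  have hG' : Real.Gamma (k + d / 2) ≠ 0 := (Real.Gamma_pos_of_pos (by positivity)).ne'
  rw [integral_inner_pow_stdGaussian, eq_div_of_mul_eq hG hn] at h
  change _ = (∫ u, (inner ℝ w u.1 : ℝ) ^ (2 * k) ∂uniformSphere d) * _ at h
  set M := ∫ u, (inner ℝ w u.1 : ℝ) ^ (2 * k) ∂uniformSphere d
  have e : (2 : ℝ) ^ (2 * k) = 2 ^ k * 2 ^ k := by rw [two_mul, pow_add]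
  rw [div_pow, e]
  field_simp at h ⊢
  linarith

/-- The Gaussian is invariant under `x ↦ -x`, and `sphereProj` is odd. -/
lemma integral_uniformSphere_exp_inner_neg (hd : 1 ≤ d) (w : EuclideanSpace ℝ (Fin d)) :
    ∫ u, Real.exp (-inner ℝ w u.1) ∂uniformSphere d =
      ∫ u, Real.exp (inner ℝ w u.1) ∂uniformSphere d := by
  have hmap := stdGaussian_map (LinearIsometryEquiv.neg ℝ (E := EuclideanSpace ℝ (Fin d)))
  rw [← integral_sphereProj hd (fun u ↦ Real.exp (-inner ℝ w u)),
    ← integral_sphereProj hd (fun u ↦ Real.exp (inner ℝ w u)), ← hmap,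
    integral_map (by fun_prop)
      (by have := measurable_sphereProj d; fun_prop), hmap]
  simp [sphereProj]

lemma integral_uniformSphere_exp_inner_eq_cosh (hd : 1 ≤ d) (w : EuclideanSpace ℝ (Fin d)) :
    ∫ u, Real.exp (inner ℝ w u.1) ∂uniformSphere d =
      ∫ u, Real.cosh (inner ℝ w u.1) ∂uniformSphere d := by
  simp only [Real.cosh_eq]
  rw [integral_div, integral_add (integrable_uniformSphere hd (by fun_prop))
    (integrable_uniformSphere hd (by fun_prop)), integral_uniformSphere_exp_inner_neg hd]
  ring

lemma hasSum_integral_uniformSphere_exp_inner (hd : 1 ≤ d) (w : EuclideanSpace ℝ (Fin d)) :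
    HasSum (fun k : ℕ ↦ Real.Gamma (d / 2) * (‖w‖ / 2) ^ (2 * k) /
        (k.factorial * Real.Gamma (k + d / 2)))
      (∫ u, Real.exp (inner ℝ w u.1) ∂uniformSphere d) := by
  have := isProbabilityMeasure_uniformSphere hd
  rw [integral_uniformSphere_exp_inner_eq_cosh hd]
  have hF (k : ℕ) : Integrable (fun u : Metric.sphere (0 : EuclideanSpace ℝ (Fin d)) 1 ↦
      (inner ℝ w u.1 : ℝ) ^ (2 * k) / (2 * k).factorial) (uniformSphere d) :=
    integrable_uniformSphere hd (by fun_prop)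
  have hbound (k : ℕ) (u : Metric.sphere (0 : EuclideanSpace ℝ (Fin d)) 1) :
      ‖(inner ℝ w u.1 : ℝ) ^ (2 * k) / (2 * k).factorial‖ ≤
        ‖w‖ ^ (2 * k) / (2 * k).factorial := by
    rw [norm_div, norm_pow, RCLike.norm_natCast]
    gcongr
    simpa using norm_inner_le_norm (𝕜 := ℝ) w u.1
  have hsum : Summable fun k : ℕ ↦ ∫ u : Metric.sphere (0 : EuclideanSpace ℝ (Fin d)) 1,
      ‖(inner ℝ w u.1 : ℝ) ^ (2 * k) / (2 * k).factorial‖ ∂uniformSphere d := by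
    -- Cauchy–Schwarz on unit vectors dominates the terms by the series of `cosh ‖w‖`, which allows
    -- the interchange.
    refine (Real.hasSum_cosh ‖w‖).summable.of_nonneg_of_le
      (fun k ↦ integral_nonneg fun _ ↦ norm_nonneg _) fun k ↦ ?_
    simpa using integral_mono (hF k).norm (integrable_const _) (hbound k)
  have h := hasSum_integral_of_summable_integral_norm hF hsum
  simp only [(Real.hasSum_cosh _).tsum_eq] at h
  convert! h using 2 with k
  rw [integral_div, integral_uniformSphere_inner_pow hd, mul_div_cancel_left₀]
  positivity

lemma vmfRadial_eq_tsum (d : ℕ) {r : ℝ} (hr : 0 < r) :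
    vmfRadial d r = ∑' k : ℕ, Real.Gamma (d / 2) * (r / 2) ^ (2 * k) /
        (k.factorial * Real.Gamma (k + d / 2)) := by
  rw [vmfRadial, besselI, ← tsum_mul_left, ← tsum_div_const]
  congr 1 with k
  rw [show (k : ℝ) + (d / 2 - 1) + 1 = k + d / 2 by ring, Real.rpow_add (by positivity),
    Real.div_rpow hr.le (by norm_num) (d / 2 - 1 : ℝ),
    show (2 : ℝ) * k = ((2 * k : ℕ) : ℝ) by push_cast; ring, Real.rpow_natCast]
  have h₁ : r ^ (d / 2 - 1 : ℝ) ≠ 0 := by positivity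
  have h₂ : (2 : ℝ) ^ (d / 2 - 1 : ℝ) ≠ 0 := by positivity
  field_simp

lemma integral_uniformSphere_exp_inner (hd : 1 ≤ d) {w : EuclideanSpace ℝ (Fin d)} (hw : w ≠ 0) :
    ∫ u, Real.exp (inner ℝ w u.1) ∂uniformSphere d = vmfRadial d ‖w‖ := by
  rw [vmfRadial_eq_tsum d (norm_pos_iff.2 hw), (hasSum_integral_uniformSphere_exp_inner hd w).tsum_eq]

/-- For `r > 0` this is the spherical integral at `r • e` with `e` a unit vector; that integral is
continuous in `r` and equals one at zero. -/
lemma tendsto_vmfRadial (hd : 1 ≤ d) : Tendsto (vmfRadial d) (𝓝[>] 0) (𝓝 1) := by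
  have := isProbabilityMeasure_uniformSphere hd
  have := nontrivial_euclideanSpace_fin hd
  obtain ⟨e, he⟩ := exists_norm_eq (EuclideanSpace ℝ (Fin d)) zero_le_one
  have hc : Continuous fun r : ℝ ↦ ∫ u, Real.exp (inner ℝ (r • e) u.1) ∂uniformSphere d := by
    have := continuous_parametric_integral_of_continuous (μ := uniformSphere d)
      (f := fun (r : ℝ) (u : Metric.sphere (0 : EuclideanSpace ℝ (Fin d)) 1) ↦
        Real.exp (inner ℝ (r • e) u.1)) (by unfold Function.uncurry; fun_prop) isCompact_univ
    simpa using this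
  have ht := (hc.tendsto 0).mono_left (nhdsWithin_le_nhds (s := Set.Ioi 0))
  simp only [zero_smul, inner_zero_left, Real.exp_zero, integral_const, probReal_univ, smul_eq_mul,
    mul_one] at ht
  refine ht.congr' ?_
  filter_upwards [self_mem_nhdsWithin] with r hr
  have hr : 0 < r := hr
  have he0 : e ≠ 0 := by rintro rfl; simp at he
  rw [integral_uniformSphere_exp_inner hd (smul_ne_zero hr.ne' he0), norm_smul, he, mul_one,
    Real.norm_of_nonneg hr.le]

lemma vmfRadial_three {r : ℝ} (hr : 0 < r) : vmfRadial 3 r = Real.sinh r / r := by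
  rw [vmfRadial_eq_tsum 3 hr, ← ((Real.hasSum_sinh r).div_const r).tsum_eq]
  congr 1 with k
  -- Duplication turns `k! Γ(k + 3/2)` into a multiple of `(2k + 1)!`, the denominator in the `sinh`
  -- series.
  have hdup := Real.Gamma_mul_Gamma_add_half (k + 1)
  rw [show (k : ℝ) + 1 + 1 / 2 = k + (3 : ℕ) / 2 by push_cast; ring,
    show 2 * ((k : ℝ) + 1) = ((2 * k + 1 : ℕ) : ℝ) + 1 by push_cast; ring,
    Real.Gamma_nat_eq_factorial, Real.Gamma_nat_eq_factorial,
    show 1 - (((2 * k + 1 : ℕ) : ℝ) + 1) = -((2 * k + 1 : ℕ) : ℝ) by ring,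
    Real.rpow_neg (by norm_num), Real.rpow_natCast] at hdup
  have hG : Real.Gamma ((3 : ℕ) / 2) = √Real.pi / 2 := by
    rw [show ((3 : ℕ) : ℝ) / 2 = 1 / 2 + 1 by norm_num, Real.Gamma_add_one (by norm_num),
      Real.Gamma_one_half_eq]
    ring
  have hpi : √Real.pi ≠ 0 := by positivity
  rw [hdup, hG, div_pow, pow_succ, pow_succ]
  field_simp

end UniformSphere

/-! ### Reduction of the kernels to the sphere. -/

section Kernel

variable {d : ℕ}

lemma nnkIntegrand_exp {X : Type*} (t : X → EuclideanSpace ℝ (Fin d)) (θi θj : NeuronParam d)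
    (x : X) : nnkIntegrand Real.exp t θi θj x =
      Real.exp (θi.2 + θj.2) * Real.exp (inner ℝ (θi.1 + θj.1) (t x)) := by
  rw [nnkIntegrand, ← Real.exp_add, ← Real.exp_add, inner_add_left]
  ring_nf

lemma nnKernel_exp_uniformSphere (θi θj : NeuronParam d) :
    nnKernel Real.exp Subtype.val (uniformSphere d) θi θj =
      Real.exp (θi.2 + θj.2) * ∫ u, Real.exp (inner ℝ (θi.1 + θj.1) u.1) ∂uniformSphere d := by
  simp only [nnKernel, nnkIntegrand_exp, integral_const_mul]

lemma nnKernel_exp_sphereProj (hd : 1 ≤ d) (θi θj : NeuronParam d) :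
    nnKernel Real.exp (sphereProj d) (stdGaussian (EuclideanSpace ℝ (Fin d))) θi θj =
      Real.exp (θi.2 + θj.2) * ∫ u, Real.exp (inner ℝ (θi.1 + θj.1) u.1) ∂uniformSphere d := by
  simp only [nnKernel, nnkIntegrand_exp, integral_const_mul]
  rw [integral_sphereProj hd (fun u ↦ Real.exp (inner ℝ (θi.1 + θj.1) u))]

lemma integrable_nnkIntegrand_uniformSphere (hd : 1 ≤ d) (θi θj : NeuronParam d) :
    Integrable (nnkIntegrand Real.exp Subtype.val θi θj) (uniformSphere d) :=
  integrable_uniformSphere hd (by unfold nnkIntegrand; fun_prop)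

/-- `sphereProj` is discontinuous at the origin, so integrability is pulled back from the
pushforward measure, where the integrand is continuous. -/
lemma integrable_nnkIntegrand_sphereProj (hd : 1 ≤ d) (θi θj : NeuronParam d) :
    Integrable (nnkIntegrand Real.exp (sphereProj d) θi θj)
      (stdGaussian (EuclideanSpace ℝ (Fin d))) := by
  have hcont : Continuous (nnkIntegrand (X := EuclideanSpace ℝ (Fin d)) Real.exp id θi θj) := by
    unfold nnkIntegrand; fun_prop
  have h : Integrable (nnkIntegrand Real.exp id θi θj)
      ((uniformSphere d).map (Subtype.val : Metric.sphere (0 : EuclideanSpace ℝ (Fin d)) 1 → _)) :=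
    (integrable_map_measure hcont.aestronglyMeasurable
      measurable_subtype_coe.aemeasurable).2 (integrable_nnkIntegrand_uniformSphere hd θi θj)
  rw [← map_sphereProj_stdGaussian hd] at h
  exact h.comp_measurable (measurable_sphereProj d)

end Kernel

theorem mainTheorem10 :
    (∀ d : ℕ, 1 ≤ d →
      -- the law of `x / ‖x‖` for a standard Gaussian `x` is the uniform measure on the sphere
      (stdGaussian (EuclideanSpace ℝ (Fin d))).map (sphereProj d) =
        (uniformSphere d).map Subtype.val ∧
      ∀ θi θj : NeuronParam d,
        -- both kernels are given by convergent integrals, and they agree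
        Integrable (nnkIntegrand Real.exp (sphereProj d) θi θj)
          (stdGaussian (EuclideanSpace ℝ (Fin d))) ∧
        Integrable (nnkIntegrand Real.exp Subtype.val θi θj) (uniformSphere d) ∧
        nnKernel Real.exp (sphereProj d) (stdGaussian (EuclideanSpace ℝ (Fin d))) θi θj =
          nnKernel Real.exp Subtype.val (uniformSphere d) θi θj ∧
        -- closed form
        (θi.1 + θj.1 ≠ 0 →
          nnKernel Real.exp (sphereProj d) (stdGaussian (EuclideanSpace ℝ (Fin d))) θi θj =
            Real.exp (θi.2 + θj.2) * vmfRadial d ‖θi.1 + θj.1‖) ∧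
        -- at `w_i + w_j = 0` the closed form is read as its limit, which is `exp (b_i + b_j)`
        (θi.1 + θj.1 = 0 →
          nnKernel Real.exp (sphereProj d) (stdGaussian (EuclideanSpace ℝ (Fin d))) θi θj =
            Real.exp (θi.2 + θj.2) ∧
          Tendsto (fun r : ℝ => Real.exp (θi.2 + θj.2) * vmfRadial d r) (𝓝[>] 0)
            (𝓝 (Real.exp (θi.2 + θj.2))))) ∧
    -- the case `d = 3`
    (∀ θi θj : NeuronParam 3, θi.1 + θj.1 ≠ 0 →
      nnKernel Real.exp (sphereProj 3) (stdGaussian (EuclideanSpace ℝ (Fin 3))) θi θj =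
        Real.exp (θi.2 + θj.2) * (Real.sinh ‖θi.1 + θj.1‖ / ‖θi.1 + θj.1‖)) := by
  refine ⟨fun d hd ↦ ⟨map_sphereProj_stdGaussian hd, fun θi θj ↦
    ⟨integrable_nnkIntegrand_sphereProj hd θi θj, integrable_nnkIntegrand_uniformSphere hd θi θj,
      ?_, fun hw ↦ ?_, fun hw ↦ ⟨?_, ?_⟩⟩⟩, fun θi θj hw ↦ ?_⟩
  · rw [nnKernel_exp_sphereProj hd, nnKernel_exp_uniformSphere]
  · rw [nnKernel_exp_sphereProj hd, integral_uniformSphere_exp_inner hd hw]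
  · have := isProbabilityMeasure_uniformSphere hd
    simp [nnKernel_exp_sphereProj hd, hw]
  · simpa using (tendsto_vmfRadial hd).const_mul (Real.exp (θi.2 + θj.2))
  · rw [nnKernel_exp_sphereProj (by norm_num), integral_uniformSphere_exp_inner (by norm_num) hw,
      vmfRadial_three (norm_pos_iff.2 hw)]
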